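/- **Setting.** Let $\mathcal X$ be a measurable space, $\mathcal H$ a non-empty set of classifiers $h:\mathcal X\to\{+1,-1\}$, $R\subseteq\mathbb R$ a set of preferences (with the trace of the Borel $\sigma$-algebra) and $c:\mathcal X\times\mathcal X\to\mathbb R_{\ge 0}$ an arbitrary cost function. A data point is a triple $(x,y,r)\in\mathcal X\times\{+1,-1\}\times R$. Facing the classifier $h$, it reports a best response, that is, a maximizer over $z\in\mathcal X$ of $$\mathbb I[h(z)=1]\cdot r-c(z;x).$$ A *best-response rule* is a map $(x,r,h)\mapsto\Delta(x,r;h)\in\mathcal X$ such that, for all $h\in\mathcal H$, $x\in\mathcal X$, $r\in R$, $\Delta(x,r;h)$ is such a maximizer whenever one exists (ties are broken arbitrarily, and if the maximum is not attained the value is arbitrary). The strategic VC dimension for $\Delta$ is $$\mathrm{SVC}(\Delta)=\sup\{n\in\mathbb N:\sigma_n(\Delta)=2^n\},\qquad \sigma_n(\Delta)=\max_{(x_i,r_i)_i\in(\mathcal X\times R)^n}\bigl|\{(h(\Delta(x_1,r_1;h)),\dots,h(\Delta(x_n,r_n;h))):h\in\mathcal H\}\bigr|.$$ Fix two best-response rules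 $\Delta_{+1},\Delta_{-1}$, where $\Delta_y$ is used by the data points with true label $y$. They may be equal; letting them differ permits the worst-case convention in which every point breaks ties against its own label. Put $d=\max\{\mathrm{SVC}(\Delta_{+1}),\mathrm{SVC}(\Delta_{-1})\}$ (so $d=\mathrm{SVC}(\Delta)$ if both rules are $\Delta$), and assume $d<\infty$. For a probability distribution $D$ of $(x,y,r)$ let $$L(h;D)=\Pr_{(x,y,r)\sim D}\bigl[h(\Delta_y(x,r;h))\ne y\bigr].$$ A *strategic ERM* (SERM) is an algorithm that maps each finite sample $(x_i,y_i,r_i)_{i\le n}$ to some $h^*\in\mathcal H$ minimizing $\sum_{i=1}^n\mathbb I[h(\Delta_{y_i}(x_i,r_i;h))\neq y_i]$ over $h\in\mathcal H$. Measurability convention: for every $h\in\mathcal H$ the map $(x,y,r)\mapsto h(\Delta_y(x,r;h))$ is measurable for the completion of every probability distribution $D$ on data points; and for every $n$ and every $v\in\{+1,-1\}^n$ the set of samples $(x_i,y_i,r_i)_{i\le n}$ such that some $h\in\mathcal H$ satisfies $h(\Delta_{y_i}(x_i,r_i;h))=v_i$ for all $i$ is measurable for the completion of every $D^n$. **Theorem.**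 There is an absolute constant $C>0$ such that in every such setting the problem $\langle\mathcal H,R,c\rangle$ is agnostic PAC learnable by SERM with sample complexity at most $C\varepsilon^{-2}(d+\log(1/\delta))$. Explicitly: a SERM exists, and there is a function $m:(0,1)^2\to\mathbb N$ with $$m(\delta,\varepsilon)\le C\,\varepsilon^{-2}\Bigl(d+\log\frac1\delta\Bigr)\qquad\text{for all }\delta,\varepsilon\in(0,1),$$ such that for every SERM, all $\delta,\varepsilon\in(0,1)$, all $n\ge m(\delta,\varepsilon)$ and every probability distribution $D$ on $\mathcal X\times\{+1,-1\}\times R$, the output $h^*$ of the SERM on $n$ i.i.d. samples from $D$ satisfies $$L(h^*;D)-\inf_{h\in\mathcal H}L(h;D)\le\varepsilon$$ with probability at least $1-\delta$ (the complementary event has outer probability at most $\delta$). -/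

import Mathlib

open MeasureTheory

noncomputable section

namespace StrategicClassification

/-- Utility of a data point with true feature `x` and preference `r` when it reports the
feature `z` to the classifier `h`; labels are Booleans, `true` is `+1` and `false` is `-1`,
and `c z x` is the cost of moving from `x` to `z`. -/
def utility {X : Type*} (c : X → X → NNReal) (h : X → Bool) (x : X) (r : ℝ) (z : X) : ℝ :=
  (if h z = true then r else 0) - (c z x : ℝ)

/-- The set `argmax_z [1(h(z) = 1) r - c(z; x)]` of best responses. -/
def bestResponses {X : Type*} (c : X → X → NNReal) (h : X → Bool) (x : X) (r : ℝ) : Set X :=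
  {z | ∀ z' : X, utility c h x r z' ≤ utility c h x r z}

/-- A rule assigning a reported feature `Δ(x, r; h)` to every feature, preference and
classifier. -/
abbrev Rule (X : Type*) (R : Set ℝ) := X → R → (X → Bool) → X

/-- `Δ` is a best-response rule for `⟨H, R, c⟩`: it selects a maximizer of the utility, with
arbitrary tie-breaking. Where the maximum is not attained nothing is required. -/
def IsBestResponseRule {X : Type*} (H : Set (X → Bool)) (R : Set ℝ) (c : X → X → NNReal)
    (Δ : Rule X R) : Prop :=
  ∀ h ∈ H, ∀ (x : X) (r : R), (bestResponses c h x r).Nonempty →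
    Δ x r h ∈ bestResponses c h x r

/-- The `n`-th strategic shattering coefficient. -/
def shatterCoeff {X : Type*} (H : Set (X → Bool)) (R : Set ℝ) (Δ : Rule X R) (n : ℕ) : ℕ∞ :=
  ⨆ p : Fin n → X × R,
    Set.encard {v : Fin n → Bool | ∃ h ∈ H, v = fun i => h (Δ (p i).1 (p i).2 h)}

/-- The strategic VC dimension `sup {n | σ_n = 2 ^ n}`. -/
def svc {X : Type*} (H : Set (X → Bool)) (R : Set ℝ) (Δ : Rule X R) : ℕ∞ :=
  ⨆ n ∈ {n : ℕ | shatterCoeff H R Δ n = 2 ^ n}, (n : ℕ∞)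

/-- A data point `(x, y, r)`. -/
abbrev DataPoint (X : Type*) (R : Set ℝ) := X × Bool × R

/-- The label that `h` gives to the manipulated feature of the data point `(x, y, r)`. Points with
true label `y` respond through the rule `Δ y`. -/
def inducedLabel {X : Type*} {R : Set ℝ} (Δ : Bool → Rule X R) (h : X → Bool)
    (p : DataPoint X R) : Bool :=
  h (Δ p.2.1 p.1 p.2.2 h)

/-- The strategic 0-1 loss `L(h; D)`: the probability that `h` mislabels the manipulated
feature. -/
def stratLoss {X : Type*} [MeasurableSpace X] {R : Set ℝ} (Δ : Bool → Rule X R)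
    (h : X → Bool) (D : Measure (DataPoint X R)) : ℝ :=
  D.real {p | inducedLabel Δ h p ≠ p.2.1}

/-- The empirical strategic 0-1 loss: the number of sample points that are mislabelled. -/
def empLoss {X : Type*} {R : Set ℝ} (Δ : Bool → Rule X R) (h : X → Bool) {n : ℕ}
    (S : Fin n → DataPoint X R) : ℕ :=
  ∑ i, if inducedLabel Δ h (S i) ≠ (S i).2.1 then 1 else 0

/-- A learning algorithm turns a finite sample into a classifier. -/
abbrev Learner (X : Type*) (R : Set ℝ) := (n : ℕ) → (Fin n → DataPoint X R) → (X → Bool)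

/-- `A` performs strategic empirical risk minimization over `H`. -/
def IsSERM {X : Type*} {R : Set ℝ} (H : Set (X → Bool)) (Δ : Bool → Rule X R)
    (A : Learner X R) : Prop :=
  ∀ (n : ℕ) (S : Fin n → DataPoint X R),
    A n S ∈ H ∧ ∀ h ∈ H, empLoss Δ (A n S) S ≤ empLoss Δ h S

/-- `A` is an agnostic PAC learner of `H` with sample complexity at most `m δ ε`. The probability
of failure is an outer probability, as the event need not be measurable. -/
def IsAgnosticPACLearner {X : Type*} [MeasurableSpace X] {R : Set ℝ} (H : Set (X → Bool))
    (Δ : Bool → Rule X R) (A : Learner X R) (m : ℝ → ℝ → ℕ) : Prop :=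
  ∀ δ ∈ Set.Ioo (0 : ℝ) 1, ∀ ε ∈ Set.Ioo (0 : ℝ) 1, ∀ n : ℕ, m δ ε ≤ n →
    ∀ (D : Measure (DataPoint X R)) [IsProbabilityMeasure D],
      (Measure.pi fun _ : Fin n => D)
        {S | ¬ (stratLoss Δ (A n S) D - (⨅ h : H, stratLoss Δ h.1 D) ≤ ε)} ≤ ENNReal.ofReal δ

/-- The standing measurability convention: each induced classifier is universally measurable, and
so is, for each finite label pattern, the set of samples on which some member of `H` induces it.
(The second part follows from the first if `H` is countable.) -/
def IsMeasurableClass {X : Type*} [MeasurableSpace X] {R : Set ℝ} (H : Set (X → Bool))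
    (Δ : Bool → Rule X R) : Prop :=
  ∀ (D : Measure (DataPoint X R)) [IsProbabilityMeasure D],
    (∀ h ∈ H, NullMeasurableSet {p | inducedLabel Δ h p = true} D) ∧
    ∀ (n : ℕ) (v : Fin n → Bool),
      NullMeasurableSet {S : Fin n → DataPoint X R | ∃ h ∈ H, ∀ i, inducedLabel Δ h (S i) = v i}
        (Measure.pi fun _ : Fin n => D)

end StrategicClassification

end

/-! Strategic behaviour enters only through the error sets, the data points that a classifier
mislabels after manipulation. Once the true label is fixed, error patterns and induced label
patterns determine each other, so a set shattered by the error sets has at most `d` points of either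
label, hence at most `2 * d` in all (`card_le_of_shattered`). What remains is uniform convergence of
frequencies over a class of finite VC dimension: if every empirical error rate is within `ε / 2` of
the true one, each empirical minimizer is `ε`-optimal.

A single union bound over all error patterns would cost an extra logarithm. Instead, after
symmetrization by a ghost sample and random swaps, the deviation is a Rademacher sum indexed by a
finite family of VC dimension at most `V`. Its packing numbers at relative scale `ρ` are at most `2
* (4 / ρ) ^ (2 * V)`, whatever the sample size (`card_le_of_separated`). Chaining along nets whose
radii shrink by the factor 4 (`card_exists_lt_abs_sum_ghostDiff_le`) splits the allowed deviation
into a summable series, and at each level Hoeffding's tail beats the growth of the net. The failure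
probability is of order `16 ^ V * exp (-c * n * ε ^ 2)`, which gives the rate without a logarithm of
`1 / ε`. -/

/-! ### Packing numbers of families of finite VC dimension -/

/-- A smooth form of the Sauer–Shelah lemma for the trace of a family on a finite set. -/
theorem card_mul_pow_le_exp_of_injOn_inter {α : Type*} [DecidableEq α]
    {𝒜 : Finset (Finset α)} {V : ℕ} (hV : ∀ s, 𝒜.Shatters s → s.card ≤ V) {S : Finset α}
    (hS : Set.InjOn (fun t => S ∩ t) 𝒜) {x : ℝ} (hx0 : 0 < x) (hx1 : x ≤ 1) :
    (𝒜.card : ℝ) * x ^ V ≤ Real.exp (x * S.card) := by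
  -- Pajor's inequality for the traces on `S`: a set shattered by the traces lies in `S` and is
  -- shattered by `𝒜` itself.
  have h1 : 𝒜.card ≤ (S.powerset.filter fun s => s.card ≤ V).card := by
    rw [← Finset.card_image_of_injOn hS]
    refine (Finset.card_le_card_shatterer _).trans (Finset.card_le_card ?_)
    intro s hs
    rw [Finset.mem_shatterer] at hs
    have hsS : s ⊆ S := by
      obtain ⟨u, hu, hsu⟩ := hs.exists_superset
      obtain ⟨t, -, rfl⟩ := Finset.mem_image.1 hu
      exact hsu.trans Finset.inter_subset_left
    refine Finset.mem_filter.2 ⟨Finset.mem_powerset.2 hsS, hV s fun t ht => ?_⟩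
    obtain ⟨u, hu, hsu⟩ := hs ht
    obtain ⟨w, hw, rfl⟩ := Finset.mem_image.1 hu
    refine ⟨w, hw, ?_⟩
    rw [← hsu, ← Finset.inter_assoc, Finset.inter_eq_left.2 hsS]
  calc (𝒜.card : ℝ) * x ^ V
      ≤ ((S.powerset.filter fun s => s.card ≤ V).card : ℝ) * x ^ V := by gcongr
    _ = ∑ s ∈ S.powerset.filter fun s => s.card ≤ V, x ^ V := by
        rw [Finset.sum_const, nsmul_eq_mul]
    _ ≤ ∑ s ∈ S.powerset.filter fun s => s.card ≤ V, x ^ s.card :=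
        Finset.sum_le_sum fun s hs =>
          pow_le_pow_of_le_one hx0.le hx1 (Finset.mem_filter.1 hs).2
    _ ≤ ∑ s ∈ S.powerset, x ^ s.card :=
        Finset.sum_le_sum_of_subset_of_nonneg (Finset.filter_subset _ _)
          fun _ _ _ => by positivity
    _ = (x + 1) ^ S.card := by
        rw [← Finset.sum_pow_mul_eq_add_pow]
        simp
    _ ≤ (Real.exp x) ^ S.card := by
        gcongr
        exact Real.add_one_le_exp x
    _ = Real.exp (x * S.card) := by rw [← Real.exp_nat_mul, mul_comm]

/-- Few random coordinates separate all members of a well-separated family. -/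
theorem exists_injOn_inter_of_separated {α : Type*} [DecidableEq α] [Fintype α] [Nonempty α]
    {𝒜 : Finset (Finset α)} {ρ : ℝ}
    (hsep : ∀ s ∈ 𝒜, ∀ t ∈ 𝒜, s ≠ t → ρ * Fintype.card α ≤ (symmDiff s t).card) {m : ℕ}
    (hm : (𝒜.card : ℝ) ^ 2 ≤ Real.exp (ρ * m)) :
    ∃ S : Finset α, S.card ≤ m ∧ Set.InjOn (fun t => S ∩ t) 𝒜 := by
  classical
  set N := Fintype.card α with hN
  have hNpos : (0 : ℝ) < N := by exact_mod_cast Fintype.card_pos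
  rcases 𝒜.eq_empty_or_nonempty with h0 | hne
  · exact ⟨∅, by simp, by simp [h0]⟩
  -- Probabilistic method: `bad p` holds the `m`-tuples that miss the symmetric difference of the
  -- pair `p`. A tuple outside all of these separates every pair.
  let bad : Finset α × Finset α → Finset (Fin m → α) := fun p =>
    Fintype.piFinset fun _ => (symmDiff p.1 p.2)ᶜ
  have hbad : ∀ p ∈ 𝒜.offDiag, ((bad p).card : ℝ) ≤ N ^ m * Real.exp (-(ρ * m)) := by
    intro p hp
    rw [Finset.mem_offDiag] at hp
    have h1 : (((symmDiff p.1 p.2)ᶜ.card : ℕ) : ℝ) ≤ N * Real.exp (-ρ) := by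
      rw [Finset.card_compl, Nat.cast_sub (Finset.card_le_univ _)]
      have := hsep _ hp.1 _ hp.2.1 hp.2.2
      have h2 := Real.add_one_le_exp (-ρ)
      have h3 := mul_le_mul_of_nonneg_left h2 hNpos.le
      rw [← hN]
      linarith
    calc ((bad p).card : ℝ) = (((symmDiff p.1 p.2)ᶜ.card : ℕ) : ℝ) ^ m := by
          simp [bad, Fintype.card_piFinset]
      _ ≤ (N * Real.exp (-ρ)) ^ m := by gcongr
      _ = N ^ m * Real.exp (-(ρ * m)) := by
          rw [mul_pow, ← Real.exp_nat_mul]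
          congr 2
          ring
  have hlt : (𝒜.offDiag.biUnion bad).card < Fintype.card (Fin m → α) := by
    have hM : (1 : ℝ) ≤ 𝒜.card := by exact_mod_cast hne.card_pos
    have hoff : (𝒜.offDiag.card : ℝ) < (𝒜.card : ℝ) ^ 2 := by
      rw [Finset.offDiag_card, Nat.cast_sub (Nat.le_mul_self _)]
      push_cast
      nlinarith
    have h1 : ((𝒜.offDiag.biUnion bad).card : ℝ) < N ^ m := by
      calc ((𝒜.offDiag.biUnion bad).card : ℝ) ≤ ∑ p ∈ 𝒜.offDiag, ((bad p).card : ℝ) := by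
            exact_mod_cast Finset.card_biUnion_le
        _ ≤ 𝒜.offDiag.card * (N ^ m * Real.exp (-(ρ * m))) := by
            rw [← nsmul_eq_mul]
            exact Finset.sum_le_card_nsmul _ _ _ hbad
        _ < Real.exp (ρ * m) * (N ^ m * Real.exp (-(ρ * m))) := by
            have : 0 < (N : ℝ) ^ m * Real.exp (-(ρ * m)) := by positivity
            exact mul_lt_mul_of_pos_right (hoff.trans_le hm) this
        _ = N ^ m := by
            rw [Real.exp_neg]
            field_simp
    rw [Fintype.card_fun, Fintype.card_fin]
    exact_mod_cast h1
  obtain ⟨g, hg⟩ : ∃ g, g ∉ 𝒜.offDiag.biUnion bad := by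
    by_contra! h
    rw [Finset.eq_univ_iff_forall.2 h, Finset.card_univ] at hlt
    exact lt_irrefl _ hlt
  refine ⟨Finset.univ.image g, Finset.card_image_le.trans (by simp), ?_⟩
  intro s hs t ht hst
  by_contra hne
  apply hg
  refine Finset.mem_biUnion.2 ⟨(s, t), Finset.mem_offDiag.2 ⟨hs, ht, hne⟩, ?_⟩
  refine Fintype.mem_piFinset.2 fun i => ?_
  have := Finset.ext_iff.1 hst (g i)
  simp only [Finset.mem_inter, Finset.mem_image, Finset.mem_univ, true_and,
    exists_apply_eq_apply] at this
  simp only [Finset.mem_compl, Finset.mem_symmDiff]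
  tauto

/-- Dudley's bound on the packing numbers of a family of finite VC dimension. -/
theorem card_le_of_separated {α : Type*} [DecidableEq α] [Fintype α] [Nonempty α]
    {𝒜 : Finset (Finset α)} {V : ℕ} (hV : ∀ s, 𝒜.Shatters s → s.card ≤ V)
    {ρ : ℝ} (hρ0 : 0 < ρ) (hρ1 : ρ ≤ 1)
    (hsep : ∀ s ∈ 𝒜, ∀ t ∈ 𝒜, s ≠ t → ρ * Fintype.card α ≤ (symmDiff s t).card) :
    (𝒜.card : ℝ) ≤ 2 * (4 / ρ) ^ (2 * V) := by
  rcases 𝒜.eq_empty_or_nonempty with h0 | hne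
  · simp only [h0, Finset.card_empty, Nat.cast_zero]
    positivity
  set M : ℝ := (𝒜.card : ℝ) with hMdef
  have hM : 1 ≤ M := by
    rw [hMdef]
    exact_mod_cast hne.card_pos
  have hM0 : 0 < M := by linarith
  have hlog : 0 ≤ Real.log M := Real.log_nonneg hM
  -- Just large enough that `M ^ 2 ≤ exp (ρ * m)`.
  set m := ⌈2 * Real.log M / ρ⌉₊ with hm
  have hm1 : 2 * Real.log M / ρ ≤ m := Nat.le_ceil _
  have hm2 : (m : ℝ) < 2 * Real.log M / ρ + 1 := Nat.ceil_lt_add_one (by positivity)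
  obtain ⟨S, hSm, hS⟩ := exists_injOn_inter_of_separated hsep (m := m) (by
    rw [← hMdef, ← Real.exp_log hM0, ← Real.exp_nat_mul, Real.exp_le_exp]
    rw [div_le_iff₀ hρ0] at hm1
    push_cast
    linarith)
  -- With `x = ρ / 4` the right side is at most `exp (1 / 4)` times the square root of `M`; squaring
  -- then lets one factor `M` cancel.
  have key := card_mul_pow_le_exp_of_injOn_inter hV hS (x := ρ / 4) (by positivity) (by linarith)
  rw [← hMdef] at key
  have hS' : (S.card : ℝ) ≤ m := by exact_mod_cast hSm
  have hexp : ρ / 4 * S.card ≤ Real.log M / 2 + 1 / 4 := by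
    calc ρ / 4 * S.card ≤ ρ / 4 * (2 * Real.log M / ρ + 1) := by
          gcongr
          linarith
      _ = Real.log M / 2 + ρ / 4 := by
          field_simp
          ring
      _ ≤ _ := by linarith
  have h2 : (M * (ρ / 4) ^ V) ^ 2 ≤ 2 * M := by
    calc (M * (ρ / 4) ^ V) ^ 2 ≤ (Real.exp (Real.log M / 2 + 1 / 4)) ^ 2 := by
          gcongr
          exact key.trans (Real.exp_le_exp.2 hexp)
      _ = M * Real.exp (1 / 2) := by
          rw [← Real.exp_nat_mul]
          push_cast
          rw [show (2 : ℝ) * (Real.log M / 2 + 1 / 4) = Real.log M + 1 / 2 by ring, Real.exp_add,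
            Real.exp_log hM0]
      _ ≤ 2 * M := by
          have : Real.exp (1 / 2) ≤ 2 := by
            have h := Real.exp_one_lt_d9
            have h' : Real.exp (1 / 2) ^ 2 = Real.exp 1 := by
              rw [← Real.exp_nat_mul]
              norm_num
            nlinarith [Real.exp_pos (1 / 2)]
          nlinarith
  have h3 : M * (ρ / 4) ^ (2 * V) ≤ 2 := by
    have : M * (M * (ρ / 4) ^ (2 * V)) ≤ M * 2 := by
      calc M * (M * (ρ / 4) ^ (2 * V)) = (M * (ρ / 4) ^ V) ^ 2 := by ring
        _ ≤ 2 * M := h2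
        _ = M * 2 := by ring
    exact le_of_mul_le_mul_left this hM0
  have h4 : (4 / ρ) ^ (2 * V) = ((ρ / 4) ^ (2 * V))⁻¹ := by rw [← inv_pow, inv_div]
  rw [h4, ← div_eq_mul_inv, le_div_iff₀ (by positivity)]
  exact h3

/-- A maximal separated subfamily is a net. -/
theorem exists_separated_net {α : Type*} [DecidableEq α] (𝒜 : Finset (Finset α)) (a : ℝ)
    (ha : 0 ≤ a) :
    ∃ ℬ ⊆ 𝒜, (∀ s ∈ ℬ, ∀ t ∈ ℬ, s ≠ t → a < (symmDiff s t).card) ∧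
      ∀ t ∈ 𝒜, ∃ s ∈ ℬ, ((symmDiff t s).card : ℝ) ≤ a := by
  classical
  obtain ⟨ℬ, hℬ⟩ := Finset.exists_maximal (s := 𝒜.powerset.filter fun ℬ =>
    ∀ s ∈ ℬ, ∀ t ∈ ℬ, s ≠ t → a < ((symmDiff s t).card : ℝ)) ⟨∅, by simp⟩
  have hmem := hℬ.prop
  rw [Finset.mem_filter, Finset.mem_powerset] at hmem
  refine ⟨ℬ, hmem.1, hmem.2, fun t ht => ?_⟩
  by_contra! hcon
  have hins : insert t ℬ ∈ 𝒜.powerset.filter fun ℬ =>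
      ∀ s ∈ ℬ, ∀ t ∈ ℬ, s ≠ t → a < ((symmDiff s t).card : ℝ) := by
    rw [Finset.mem_filter, Finset.mem_powerset]
    refine ⟨Finset.insert_subset ht hmem.1, ?_⟩
    intro u hu v hv huv
    rcases Finset.mem_insert.1 hu with rfl | hu' <;> rcases Finset.mem_insert.1 hv with rfl | hv'
    · exact absurd rfl huv
    · exact hcon v hv'
    · rw [symmDiff_comm]
      exact hcon u hu'
    · exact hmem.2 u hu' v hv' huv
  have htB : t ∈ ℬ := hℬ.le_of_ge hins (Finset.subset_insert _ _) (Finset.mem_insert_self _ _)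
  have := hcon t htB
  simp only [symmDiff_self, Finset.bot_eq_empty, Finset.card_empty, Nat.cast_zero] at this
  linarith

/-! ### Rademacher sums and chaining -/

/-- The sign `1` or `-1` encoded by a Boolean. -/
noncomputable def boolSign (b : Bool) : ℝ := if b then 1 else -1

/-- Hoeffding's inequality for a Rademacher sum, one-sided. -/
theorem card_lt_sum_boolSign_mul_le {ι : Type*} [Fintype ι] [DecidableEq ι] (a : ι → ℝ)
    {v l : ℝ} (hv : 0 < v) (hl : 0 ≤ l) (ha : ∑ i, a i ^ 2 ≤ v) :
    ((Finset.univ.filter fun σ : ι → Bool => l < ∑ i, boolSign (σ i) * a i).card : ℝ) ≤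
      2 ^ Fintype.card ι * Real.exp (-(l ^ 2 / (2 * v))) := by
  -- The minimizer of the Chernoff exponent `s ^ 2 * v / 2 - s * l`.
  set s := l / v with hs
  have hs0 : 0 ≤ s := by positivity
  have hmgf : ∑ σ : ι → Bool, Real.exp (s * ∑ i, boolSign (σ i) * a i) ≤
      2 ^ Fintype.card ι * Real.exp (s ^ 2 * v / 2) := by
    calc ∑ σ : ι → Bool, Real.exp (s * ∑ i, boolSign (σ i) * a i)
        = ∑ σ : ι → Bool, ∏ i, Real.exp (s * (boolSign (σ i) * a i)) := by
          refine Finset.sum_congr rfl fun σ _ => ?_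
          rw [Finset.mul_sum, Real.exp_sum]
      _ = ∏ i, ∑ b : Bool, Real.exp (s * (boolSign b * a i)) := by
          rw [Finset.prod_univ_sum, Fintype.piFinset_univ]
      _ ≤ ∏ i, (2 * Real.exp (s ^ 2 * a i ^ 2 / 2)) := by
          refine Finset.prod_le_prod (fun i _ => by positivity) fun i _ => ?_
          have h := Real.cosh_le_exp_half_sq (s * a i)
          rw [Real.cosh_eq, mul_pow] at h
          simp only [Fintype.sum_bool, boolSign, if_true, Bool.false_eq_true, if_false, one_mul,
            neg_mul, mul_neg]
          linarith
      _ = 2 ^ Fintype.card ι * Real.exp (s ^ 2 * (∑ i, a i ^ 2) / 2) := by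
          rw [Finset.prod_mul_distrib, Finset.prod_const, Finset.card_univ, ← Real.exp_sum,
            Finset.mul_sum, Finset.sum_div]
      _ ≤ _ := by gcongr
  have hmarkov : ((Finset.univ.filter fun σ : ι → Bool =>
      l < ∑ i, boolSign (σ i) * a i).card : ℝ) * Real.exp (s * l) ≤
      ∑ σ : ι → Bool, Real.exp (s * ∑ i, boolSign (σ i) * a i) := by
    rw [← nsmul_eq_mul]
    refine (Finset.card_nsmul_le_sum _ _ _ fun σ hσ => ?_).trans
      (Finset.sum_le_sum_of_subset_of_nonneg (Finset.filter_subset _ _)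
        fun _ _ _ => (Real.exp_pos _).le)
    have := (Finset.mem_filter.1 hσ).2
    gcongr
  have h := hmarkov.trans hmgf
  rw [← le_div_iff₀ (Real.exp_pos _), mul_div_assoc, ← Real.exp_sub] at h
  refine h.trans (le_of_eq ?_)
  congr 2
  rw [hs]
  field_simp
  ring

/-- Hoeffding's inequality for a Rademacher sum. -/
theorem card_lt_abs_sum_boolSign_mul_le {ι : Type*} [Fintype ι] [DecidableEq ι] (a : ι → ℝ)
    {v l : ℝ} (hv : 0 < v) (hl : 0 ≤ l) (ha : ∑ i, a i ^ 2 ≤ v) :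
    ((Finset.univ.filter fun σ : ι → Bool => l < |∑ i, boolSign (σ i) * a i|).card : ℝ) ≤
      2 ^ Fintype.card ι * (2 * Real.exp (-(l ^ 2 / (2 * v)))) := by
  have h1 := card_lt_sum_boolSign_mul_le a hv hl ha
  have h2 := card_lt_sum_boolSign_mul_le (fun i => -a i) hv hl (by simpa using ha)
  have h3 : (Finset.univ.filter fun σ : ι → Bool => l < |∑ i, boolSign (σ i) * a i|) ⊆
      (Finset.univ.filter fun σ : ι → Bool => l < ∑ i, boolSign (σ i) * a i) ∪
      (Finset.univ.filter fun σ : ι → Bool => l < ∑ i, boolSign (σ i) * -a i) := by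
    intro σ hσ
    simpa [lt_abs] using hσ
  have h4 := (Finset.card_le_card h3).trans (Finset.card_union_le _ _)
  have h5 : ((Finset.univ.filter fun σ : ι → Bool =>
      l < |∑ i, boolSign (σ i) * a i|).card : ℝ) ≤ _ := Nat.cast_le.2 h4
  push_cast at h5
  linarith

/-- The difference between the indicators of `t` on the second and on the first copy of `ι`. -/
noncomputable def ghostDiff {ι : Type*} [DecidableEq ι] (t : Finset (ι ⊕ ι)) (i : ι) : ℝ :=
  (if Sum.inr i ∈ t then 1 else 0) - (if Sum.inl i ∈ t then 1 else 0)

theorem sum_ghostDiff_sq_le {ι : Type*} [Fintype ι] [DecidableEq ι] (t : Finset (ι ⊕ ι)) :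
    ∑ i, ghostDiff t i ^ 2 ≤ Fintype.card ι := by
  have h : ∀ i ∈ (Finset.univ : Finset ι), ghostDiff t i ^ 2 ≤ 1 := by
    intro i _
    unfold ghostDiff
    split_ifs <;> norm_num
  refine (Finset.sum_le_card_nsmul _ _ _ h).trans ?_
  simp

/-- Each index satisfies `(a - b) ^ 2 ≤ 2 * (a ^ 2 + b ^ 2)`, where `a`, `b` are the changes on its
two copies, of absolute value at most 1. Thus closeness in symmetric difference controls the
variance of a chain increment. -/
theorem sum_sq_ghostDiff_sub_le {ι : Type*} [Fintype ι] [DecidableEq ι]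
    (s t : Finset (ι ⊕ ι)) :
    ∑ i, (ghostDiff s i - ghostDiff t i) ^ 2 ≤ 2 * (symmDiff s t).card := by
  have h : ((symmDiff s t).card : ℝ) =
      ∑ i, ((if Sum.inl i ∈ symmDiff s t then 1 else 0) +
        (if Sum.inr i ∈ symmDiff s t then 1 else 0) : ℝ) := by
    rw [Finset.sum_add_distrib, ← Fintype.sum_sum_type
      (fun x : ι ⊕ ι => (if x ∈ symmDiff s t then 1 else 0 : ℝ))]
    simp
  rw [h, Finset.mul_sum]
  refine Finset.sum_le_sum fun i _ => ?_
  unfold ghostDiff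
  simp only [Finset.mem_symmDiff]
  by_cases h1 : Sum.inl i ∈ s <;> by_cases h2 : Sum.inl i ∈ t <;>
    by_cases h3 : Sum.inr i ∈ s <;> by_cases h4 : Sum.inr i ∈ t <;>
    simp [h1, h2, h3, h4] <;> norm_num

/-- Keeps the total of the level thresholds below 4, whence the factor `1 / 4` in each of them. -/
theorem sum_range_succ_div_two_pow (J : ℕ) :
    ∑ i ∈ Finset.range J, ((i : ℝ) + 1) / 2 ^ i = 4 - 2 * (J + 2) / 2 ^ J := by
  induction J with
  | zero => norm_num
  | succ J ih =>
    rw [Finset.sum_range_succ, ih]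
    push_cast
    field_simp
    ring

theorem sum_range_pow_succ_le {y : ℝ} (hy0 : 0 ≤ y) (hy : y ≤ 1 / 2) (J : ℕ) :
    ∑ i ∈ Finset.range J, y ^ (i + 1) ≤ 2 * y := by
  have h : ∑ i ∈ Finset.range J, y ^ (i + 1) ≤ ∑ i ∈ Finset.range J, y * (1 / 2) ^ i := by
    refine Finset.sum_le_sum fun i _ => ?_
    rw [pow_succ']
    gcongr
  rw [← Finset.mul_sum] at h
  have h2 := sum_geometric_two_le J
  nlinarith

/-- The sign patterns for which some Rademacher sum indexed by `T` exceeds `l` in absolute value. -/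
noncomputable def exceedSet {ι κ : Type*} [Fintype ι] [DecidableEq ι] (T : Finset κ) (a : κ → ι → ℝ) (l : ℝ) :
    Finset (ι → Bool) :=
  open Classical in
  Finset.univ.filter fun σ : ι → Bool => ∃ t ∈ T, l < |∑ i, boolSign (σ i) * a t i|

theorem mem_exceedSet {ι κ : Type*} [Fintype ι] [DecidableEq ι] {T : Finset κ} {a : κ → ι → ℝ}
    {l : ℝ} {σ : ι → Bool} :
    σ ∈ exceedSet T a l ↔ ∃ t ∈ T, l < |∑ i, boolSign (σ i) * a t i| := by
  simp [exceedSet]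

/-- Union bound over one level of the chain. -/
theorem card_exists_lt_abs_sum_le {ι κ : Type*} [Fintype ι] [DecidableEq ι] [Nonempty ι]
    (T : Finset κ) {V j : ℕ} (hT : (T.card : ℝ) ≤ 2 * (4 * 4 ^ j) ^ (2 * V)) {ε : ℝ} (hε : 0 < ε)
    (a : κ → ι → ℝ) (ha : ∀ t ∈ T, ∑ i, a t i ^ 2 ≤ 16 * Fintype.card ι / 4 ^ j) :
    ((exceedSet T a (Fintype.card ι * ε * ((j + 1) / 2 ^ j / 4))).card : ℝ) ≤
      2 ^ Fintype.card ι *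
        (4 * 16 ^ V * Real.exp (-(Fintype.card ι * ε ^ 2 / 512))) ^ (j + 1) := by
  classical
  set n : ℝ := (Fintype.card ι : ℝ) with hn
  have hn0 : 0 < n := by
    rw [hn]
    exact_mod_cast Fintype.card_pos
  set l : ℝ := n * ε * ((j + 1) / 2 ^ j / 4) with hl
  have hl0 : 0 ≤ l := by positivity
  have hsub : exceedSet T a l ⊆
      T.biUnion fun t => Finset.univ.filter fun σ : ι → Bool =>
        l < |∑ i, boolSign (σ i) * a t i| := by
    intro σ hσ
    simpa using mem_exceedSet.1 hσ
  -- The powers of 2 in threshold and variance cancel. The surviving `(j + 1) ^ 2` is weakened below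
  -- to `j + 1`, the exponent in which the net size grows.
  have hexp : l ^ 2 / (2 * (16 * n / 4 ^ j)) = n * ε ^ 2 / 512 * ((j : ℝ) + 1) ^ 2 := by
    rw [hl, show (4 : ℝ) ^ j = 2 ^ j * 2 ^ j by rw [← mul_pow]; norm_num]
    field_simp
    ring
  have hle : Real.exp (-(l ^ 2 / (2 * (16 * n / 4 ^ j)))) ≤
      Real.exp (-(n * ε ^ 2 / 512)) ^ (j + 1) := by
    rw [hexp, ← Real.exp_nat_mul, Real.exp_le_exp]
    have hq : 0 ≤ n * ε ^ 2 / 512 := by positivity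
    have hj : (0 : ℝ) ≤ j := by positivity
    push_cast
    nlinarith [mul_nonneg hq (mul_nonneg hj (by linarith : (0 : ℝ) ≤ j + 1))]
  calc ((exceedSet T a l).card : ℝ)
      ≤ ∑ t ∈ T, ((Finset.univ.filter fun σ : ι → Bool =>
        l < |∑ i, boolSign (σ i) * a t i|).card : ℝ) := by
        exact_mod_cast (Finset.card_le_card hsub).trans Finset.card_biUnion_le
    _ ≤ T.card * (2 ^ Fintype.card ι * (2 * Real.exp (-(l ^ 2 / (2 * (16 * n / 4 ^ j)))))) := by
        rw [← nsmul_eq_mul]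
        refine Finset.sum_le_card_nsmul _ _ _ fun t ht => ?_
        exact card_lt_abs_sum_boolSign_mul_le _ (by positivity) hl0 (ha t ht)
    _ ≤ 2 * (4 * 4 ^ j) ^ (2 * V) *
        (2 ^ Fintype.card ι * (2 * Real.exp (-(n * ε ^ 2 / 512)) ^ (j + 1))) := by gcongr
    _ = 2 ^ Fintype.card ι *
        (4 * (16 ^ V * Real.exp (-(n * ε ^ 2 / 512))) ^ (j + 1)) := by
        have : ((4 : ℝ) * 4 ^ j) ^ (2 * V) = (16 ^ V) ^ (j + 1) := by
          rw [← pow_succ', show (16 : ℝ) = 4 ^ 2 by norm_num, ← pow_mul, ← pow_mul, ← pow_mul]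
          ring_nf
        rw [this, mul_pow]
        ring
    _ ≤ 2 ^ Fintype.card ι *
        (4 ^ (j + 1) * (16 ^ V * Real.exp (-(n * ε ^ 2 / 512))) ^ (j + 1)) := by
        gcongr
        exact le_self_pow₀ (by norm_num) (by omega)
    _ = _ := by
        rw [← mul_pow]
        ring_nf

/-- Chaining: the Rademacher process indexed by a family of finite VC dimension is uniformly
small on all but a small proportion of the sign patterns. -/
theorem card_exists_lt_abs_sum_ghostDiff_le {ι : Type*} [Fintype ι] [DecidableEq ι] [Nonempty ι]
    {𝒜 : Finset (Finset (ι ⊕ ι))} {V : ℕ} (hV : ∀ s, 𝒜.Shatters s → s.card ≤ V)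
    {ε δ : ℝ} (hε : 0 < ε) (hδ : δ ≤ 1)
    (h : 8 * 16 ^ V * Real.exp (-(Fintype.card ι * ε ^ 2 / 512)) ≤ δ) :
    ((exceedSet 𝒜 ghostDiff (Fintype.card ι * ε)).card : ℝ) ≤
      2 ^ Fintype.card ι * δ := by
  classical
  set n : ℝ := (Fintype.card ι : ℝ) with hn
  have hn0 : 0 < n := by
    rw [hn]
    exact_mod_cast Fintype.card_pos
  have hcard : (Fintype.card (ι ⊕ ι) : ℝ) = 2 * n := by
    rw [Fintype.card_sum]
    push_cast
    ring
  set y : ℝ := 4 * 16 ^ V * Real.exp (-(n * ε ^ 2 / 512)) with hy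
  have hy0 : 0 ≤ y := by positivity
  have hyδ : 2 * y ≤ δ := by
    rw [hy]
    linarith
  -- The ground set has `2 * n` points, so level `j` has relative scale `1 / 4 ^ j`.
  choose T hTsub hTsep hTnet using fun j : ℕ =>
    exists_separated_net 𝒜 (2 * n / 4 ^ j) (by positivity)
  have hTcard : ∀ j, ((T j).card : ℝ) ≤ 2 * (4 * 4 ^ j) ^ (2 * V) := by
    intro j
    have h4 : (1 : ℝ) ≤ 4 ^ j := one_le_pow₀ (by norm_num)
    have := card_le_of_separated (𝒜 := T j) (V := V) (ρ := 1 / 4 ^ j)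
      (fun s hs => hV s (hs.mono_left (hTsub j))) (by positivity)
      (by rw [div_le_one (by positivity)]; exact h4)
      (fun s hs t ht hst => by
        rw [hcard]
        refine le_trans (le_of_eq ?_) (hTsep j s hs t ht hst).le
        ring)
    simpa [div_div_eq_mul_div] using this
  set Λ : ℕ → ℝ := fun J => ∑ i ∈ Finset.range J, n * ε * ((i + 1) / 2 ^ i / 4) with hΛ
  have hΛle : ∀ J, Λ J ≤ n * ε := by
    intro J
    have h1 : Λ J = n * ε / 4 * ∑ i ∈ Finset.range J, ((i : ℝ) + 1) / 2 ^ i := by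
      rw [hΛ, Finset.mul_sum]
      exact Finset.sum_congr rfl fun i _ => by ring
    rw [h1, sum_range_succ_div_two_pow]
    have h2 : (0 : ℝ) ≤ 2 * (J + 2) / 2 ^ J := by positivity
    have h3 : 0 < n * ε := by positivity
    nlinarith
  have main : ∀ J, ((exceedSet (T J) ghostDiff (Λ (J + 1))).card : ℝ) ≤
      2 ^ Fintype.card ι * ∑ i ∈ Finset.range (J + 1), y ^ (i + 1) := by
    intro J
    induction J with
    | zero =>
      have := card_exists_lt_abs_sum_le (T 0) (hTcard 0) hε ghostDiff
        (fun t _ => (sum_ghostDiff_sq_le t).trans (by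
          rw [pow_zero, div_one]
          linarith))
      simpa [hΛ] using this
    | succ J ih =>
      -- Each member of the finer net is linked to a close member of the coarser one; off the net
      -- the value is a dummy.
      have hπ : ∀ t, ∃ s, t ∈ T (J + 1) → s ∈ T J ∧ ((symmDiff t s).card : ℝ) ≤ 2 * n / 4 ^ J := by
        intro t
        by_cases ht : t ∈ T (J + 1)
        · obtain ⟨s, hs⟩ := hTnet J t (hTsub _ ht)
          exact ⟨s, fun _ => hs⟩
        · exact ⟨∅, fun h => absurd h ht⟩
      choose π hπ using hπ
      have hlevel := card_exists_lt_abs_sum_le (T (J + 1)) (hTcard (J + 1)) hε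
        (fun t i => ghostDiff t i - ghostDiff (π t) i) (fun t ht => by
          refine (sum_sq_ghostDiff_sub_le _ _).trans ?_
          have := (hπ t ht).2
          rw [pow_succ, ← hn]
          -- The coarser radius `2 * n / 4 ^ J` doubles to `4 * n / 4 ^ J = 16 * n / 4 ^ (J + 1)`:
          -- the source of the 16.
          calc (2 : ℝ) * _ ≤ 2 * (2 * n / 4 ^ J) := by gcongr
            _ = _ := by
              field_simp
              norm_num)
      have hsub : exceedSet (T (J + 1)) ghostDiff (Λ (J + 1 + 1)) ⊆
          exceedSet (T J) ghostDiff (Λ (J + 1)) ∪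
          exceedSet (T (J + 1)) (fun t i => ghostDiff t i - ghostDiff (π t) i)
            (n * ε * (((J + 1 : ℕ) + 1) / 2 ^ (J + 1) / 4)) := by
        intro σ hσ
        obtain ⟨t, ht, hlt⟩ := mem_exceedSet.1 hσ
        by_contra hcon
        simp only [Finset.mem_union, mem_exceedSet, not_or, not_exists, not_and, not_lt] at hcon
        have h1 := hcon.1 (π t) (hπ t ht).1
        have h2 := hcon.2 t ht
        have h3 : ∑ i, boolSign (σ i) * ghostDiff t i =
            ∑ i, boolSign (σ i) * ghostDiff (π t) i +
              ∑ i, boolSign (σ i) * (ghostDiff t i - ghostDiff (π t) i) := by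
          rw [← Finset.sum_add_distrib]
          exact Finset.sum_congr rfl fun i _ => by ring
        have h4 : Λ (J + 1 + 1) = Λ (J + 1) + n * ε * (((J + 1 : ℕ) + 1) / 2 ^ (J + 1) / 4) := by
          simp only [hΛ]
          rw [Finset.sum_range_succ]
        rw [h3, h4] at hlt
        have h5 := abs_add_le (∑ i, boolSign (σ i) * ghostDiff (π t) i)
          (∑ i, boolSign (σ i) * (ghostDiff t i - ghostDiff (π t) i))
        linarith
      have hc : ((exceedSet (T (J + 1)) ghostDiff (Λ (J + 1 + 1))).card : ℝ) ≤ _ :=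
        Nat.cast_le.2 ((Finset.card_le_card hsub).trans (Finset.card_union_le _ _))
      rw [Nat.cast_add] at hc
      rw [Finset.sum_range_succ, mul_add]
      exact hc.trans (add_le_add ih hlevel)
  -- At radius below 1 the net is the whole family, so the chain ends exactly.
  obtain ⟨J, hJ⟩ : ∃ J : ℕ, 2 * n < 4 ^ J := pow_unbounded_of_one_lt _ (by norm_num)
  have hfin : exceedSet 𝒜 ghostDiff (n * ε) ⊆ exceedSet (T J) ghostDiff (Λ (J + 1)) := by
    intro σ hσ
    obtain ⟨t, ht, hlt⟩ := mem_exceedSet.1 hσ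
    obtain ⟨s, hs, hts⟩ := hTnet J t ht
    have h1 : ((symmDiff t s).card : ℝ) < 1 :=
      hts.trans_lt (by rwa [div_lt_one (by positivity)])
    have h2 : (symmDiff t s).card = 0 := by
      have : (symmDiff t s).card < 1 := by exact_mod_cast h1
      omega
    rw [Finset.card_eq_zero, ← Finset.bot_eq_empty, symmDiff_eq_bot] at h2
    exact mem_exceedSet.2 ⟨t, h2 ▸ hs, (hΛle _).trans_lt hlt⟩
  calc ((exceedSet 𝒜 ghostDiff (n * ε)).card : ℝ)
      ≤ _ := Nat.cast_le.2 (Finset.card_le_card hfin)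
    _ ≤ _ := main J
    _ ≤ 2 ^ Fintype.card ι * δ := by
        gcongr
        exact (sum_range_pow_succ_le hy0 (by linarith) _).trans hyδ

/-! ### Symmetrization and uniform convergence -/

/-- The number of points of the sample `S` that lie in `E`. -/
noncomputable def hitCount {Z ι : Type*} [Fintype ι] (E : Set Z) (S : ι → Z) : ℝ :=
  ∑ i, E.indicator (fun _ => (1 : ℝ)) (S i)

/-- Chebyshev: an indicator has variance at most `1 / 4`, and variances add over independent points.
-/
theorem measure_le_abs_hitCount_sub_le {Z ι : Type*} [MeasurableSpace Z] [Fintype ι] [Nonempty ι]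
    (D : Measure Z) [IsProbabilityMeasure D] {E : Set Z} (hE : NullMeasurableSet E D) {ε : ℝ}
    (hε : 0 < ε) :
    (Measure.pi fun _ : ι => D)
        {S | Fintype.card ι * ε ≤ |hitCount E S - Fintype.card ι * D.real E|} ≤
      ENNReal.ofReal (1 / (4 * Fintype.card ι * ε ^ 2)) := by
  have hn0 : (0 : ℝ) < Fintype.card ι := by exact_mod_cast Fintype.card_pos
  set f : Z → ℝ := E.indicator fun _ => (1 : ℝ) with hf
  have hfm : AEStronglyMeasurable f D :=
    (aestronglyMeasurable_const (b := (1 : ℝ))).indicator₀ hE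
  have hf01 : ∀ z, f z ∈ Set.Icc (0 : ℝ) 1 := by
    intro z
    by_cases hz : z ∈ E <;> simp [hf, hz]
  have hf2 : MemLp f 2 D := MemLp.of_bound hfm 1 (by
    refine Filter.Eventually.of_forall fun z => ?_
    rw [Real.norm_eq_abs, abs_le]
    exact ⟨by linarith [(hf01 z).1], (hf01 z).2⟩)
  have hfint : ∫ z, f z ∂D = D.real E := by
    rw [hf, integral_indicator₀ hE]
    simp
  have hcomp : ∀ i : ι, MemLp (fun S : ι → Z => f (S i)) 2 (Measure.pi fun _ : ι => D) :=
    fun i => hf2.comp_measurePreserving (measurePreserving_eval (fun _ : ι => D) i)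
  have hsum : MemLp (∑ i : ι, fun S : ι → Z => f (S i)) 2 (Measure.pi fun _ : ι => D) :=
    memLp_finsetSum' _ fun i _ => hcomp i
  have hmean : ∫ S, (∑ i : ι, fun S : ι → Z => f (S i)) S ∂(Measure.pi fun _ : ι => D) =
      Fintype.card ι * D.real E := by
    simp only [Finset.sum_apply]
    rw [integral_finsetSum _ fun i _ => (hcomp i).integrable (by norm_num)]
    have : ∀ i : ι, ∫ S : ι → Z, f (S i) ∂(Measure.pi fun _ : ι => D) = D.real E := fun i => by
      rw [← hfint]
      exact integral_comp_eval (μ := fun _ : ι => D) (i := i) (f := f) hfm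
    simp [this]
  have hvar : ProbabilityTheory.variance (∑ i : ι, fun S : ι → Z => f (S i))
      (Measure.pi fun _ : ι => D) ≤ Fintype.card ι * (1 / 4) := by
    rw [ProbabilityTheory.variance_sum_pi (μ := fun _ : ι => D) (X := fun _ => f) fun _ => hf2]
    have := ProbabilityTheory.variance_le_sq_of_bounded (μ := D) (X := f) (a := 0) (b := 1)
      (Filter.Eventually.of_forall hf01) hfm.aemeasurable
    simp only [Finset.sum_const, Finset.card_univ, nsmul_eq_mul]
    gcongr
    exact this.trans (by norm_num)
  have hcheb := ProbabilityTheory.meas_ge_le_variance_div_sq hsum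
    (c := Fintype.card ι * ε) (by positivity)
  rw [hmean] at hcheb
  simp only [Finset.sum_apply] at hcheb
  refine hcheb.trans (ENNReal.ofReal_le_ofReal ?_)
  rw [div_le_iff₀ (by positivity)]
  refine hvar.trans (le_of_eq ?_)
  field_simp

/-- Symmetrization by a ghost sample, for outer measures. -/
theorem measure_exists_lt_abs_hitCount_sub_le {Z ι κ : Type*} [MeasurableSpace Z] [Fintype ι]
    [Nonempty ι] (D : Measure Z) [IsProbabilityMeasure D] (E : κ → Set Z)
    (hE : ∀ h, NullMeasurableSet (E h) D) {ε : ℝ} (hε : 0 < ε)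
    (hn : 2 ≤ Fintype.card ι * ε ^ 2) :
    (Measure.pi fun _ : ι => D)
        {S | ∃ h, Fintype.card ι * ε < |hitCount (E h) S - Fintype.card ι * D.real (E h)|} ≤
      2 * ((Measure.pi fun _ : ι => D).prod (Measure.pi fun _ : ι => D))
        {p | ∃ h, Fintype.card ι * (ε / 2) < |hitCount (E h) p.2 - hitCount (E h) p.1|} := by
  set μ := Measure.pi fun _ : ι => D with hμ
  set n : ℝ := (Fintype.card ι : ℝ) with hndef
  have hn0 : 0 < n := by
    rw [hndef]
    exact_mod_cast Fintype.card_pos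
  set B : Set ((ι → Z) × (ι → Z)) :=
    {p | ∃ h, n * (ε / 2) < |hitCount (E h) p.2 - hitCount (E h) p.1|} with hB
  -- `B` may be non-measurable; its measurable hull has the same measure and allows integration over
  -- sections.
  set B' := toMeasurable (μ.prod μ) B with hB'
  have hB'm : MeasurableSet B' := measurableSet_toMeasurable _ _
  -- Fix a classifier index that witnesses the deviation on `S`. A ghost sample is within `ε / 2`
  -- for this index with probability at least one half, and then the two samples disagree. Markov's
  -- inequality for the section measures concludes.
  have hsub : {S | ∃ h, n * ε < |hitCount (E h) S - n * D.real (E h)|} ⊆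
      {S | (2 : ENNReal)⁻¹ ≤ μ (Prod.mk S ⁻¹' B')} := by
    rintro S ⟨h, hS⟩
    set G : Set (ι → Z) := {S' | n * (ε / 2) ≤ |hitCount (E h) S' - n * D.real (E h)|} with hG
    have hGle : μ G ≤ 2⁻¹ := by
      refine (measure_le_abs_hitCount_sub_le D (hE h) (half_pos hε)).trans ?_
      rw [show (2 : ENNReal)⁻¹ = ENNReal.ofReal 2⁻¹ by
        rw [ENNReal.ofReal_inv_of_pos (by norm_num)]; simp]
      refine ENNReal.ofReal_le_ofReal ?_
      rw [div_le_iff₀ (by positivity)]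
      nlinarith
    have hGc : Gᶜ ⊆ Prod.mk S ⁻¹' B' := by
      intro S' hS'
      refine subset_toMeasurable _ _ ⟨h, ?_⟩
      have h1 : |hitCount (E h) S' - n * D.real (E h)| < n * (ε / 2) := not_le.1 hS'
      have h2 := abs_sub_le (hitCount (E h) S) (hitCount (E h) S') (n * D.real (E h))
      rw [abs_sub_comm (hitCount (E h) S) (hitCount (E h) S')] at h2
      linarith
    have h1 : (1 : ENNReal) ≤ 2⁻¹ + μ (Prod.mk S ⁻¹' B') := by
      calc (1 : ENNReal) = μ (G ∪ Gᶜ) := by rw [Set.union_compl_self, measure_univ]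
        _ ≤ μ G + μ Gᶜ := measure_union_le _ _
        _ ≤ _ := add_le_add hGle (measure_mono hGc)
    rw [← ENNReal.inv_two_add_inv_two] at h1
    exact (ENNReal.add_le_add_iff_left (by simp)).1 h1
  have hmk := mul_meas_ge_le_lintegral (μ := μ) (measurable_measure_prodMk_left (ν := μ) hB'm) 2⁻¹
  rw [← Measure.prod_apply hB'm, hB', measure_toMeasurable] at hmk
  calc μ _ ≤ μ {S | (2 : ENNReal)⁻¹ ≤ μ (Prod.mk S ⁻¹' B')} := measure_mono hsub
    _ = 2 * (2⁻¹ * μ {S | (2 : ENNReal)⁻¹ ≤ μ (Prod.mk S ⁻¹' B')}) := by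
        rw [← mul_assoc, ENNReal.mul_inv_cancel (by simp) (by simp), one_mul]
    _ ≤ _ := by gcongr

/-- The permutation that exchanges the two copies of `i` whenever `σ i` is false. -/
def ghostSwap {ι : Type*} (σ : ι → Bool) : Equiv.Perm (ι ⊕ ι) :=
  Function.Involutive.toPerm
    (Sum.elim (fun i => if σ i then Sum.inl i else Sum.inr i)
      fun i => if σ i then Sum.inr i else Sum.inl i)
    (by rintro (i | i) <;> cases h : σ i <;> simp [h])

theorem ghostSwap_inl {ι : Type*} (σ : ι → Bool) (i : ι) :
    ghostSwap σ (Sum.inl i) = if σ i then Sum.inl i else Sum.inr i :=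
  rfl

theorem ghostSwap_inr {ι : Type*} (σ : ι → Bool) (i : ι) :
    ghostSwap σ (Sum.inr i) = if σ i then Sum.inr i else Sum.inl i :=
  rfl

theorem measurePreserving_comp_perm {Z ι ι' : Type*} [MeasurableSpace Z] [Fintype ι] [Fintype ι']
    (D : Measure Z) [IsProbabilityMeasure D] (τ : ι ≃ ι') :
    MeasurePreserving (fun W : ι' → Z => W ∘ τ) (Measure.pi fun _ => D) (Measure.pi fun _ => D) :=
  measurePreserving_arrowCongr' (fun _ : ι' => D) (fun _ : ι => D) τ.symm (MeasurableEquiv.refl Z)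
    fun _ => MeasurePreserving.id D

/-- The sign patterns that produce a large deviation on a fixed double sample are rare. -/
theorem sum_indicator_comp_ghostSwap_le {Z ι κ : Type*} [Fintype ι] [DecidableEq ι] [Nonempty ι]
    (E : κ → Set Z) {V : ℕ}
    (hV : ∀ A : Finset Z, (∀ u ⊆ A, ∃ h, ∀ z ∈ A, z ∈ E h ↔ z ∈ u) → A.card ≤ V)
    {ε δ : ℝ} (hε : 0 < ε) (hδ : δ ≤ 1)
    (h : 8 * 16 ^ V * Real.exp (-(Fintype.card ι * ε ^ 2 / 512)) ≤ δ) (W : ι ⊕ ι → Z) :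
    ∑ σ : ι → Bool, {W : ι ⊕ ι → Z | ∃ h, Fintype.card ι * ε <
        |hitCount (E h) (W ∘ Sum.inr) - hitCount (E h) (W ∘ Sum.inl)|}.indicator
          (fun _ => (1 : ENNReal)) (W ∘ ghostSwap σ) ≤
      2 ^ Fintype.card ι * ENNReal.ofReal δ := by
  classical
  set B := {W : ι ⊕ ι → Z | ∃ h, Fintype.card ι * ε <
        |hitCount (E h) (W ∘ Sum.inr) - hitCount (E h) (W ∘ Sum.inl)|} with hB
  set 𝒜 : Finset (Finset (ι ⊕ ι)) :=
    Finset.univ.filter fun t => ∃ h, ∀ i, i ∈ t ↔ W i ∈ E h with h𝒜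
  have hVC : ∀ s, 𝒜.Shatters s → s.card ≤ V := by
    intro s hs
    have hpat : ∀ t ⊆ s, ∃ h, ∀ i ∈ s, W i ∈ E h ↔ i ∈ t := by
      intro t ht
      obtain ⟨u, hu, rfl⟩ := hs ht
      obtain ⟨h, hh⟩ := (Finset.mem_filter.1 hu).2
      refine ⟨h, fun i hi => ?_⟩
      rw [← hh i, Finset.mem_inter]
      tauto
    -- Indices carrying the same point cannot be told apart, so a shattered index set gives equally
    -- many distinct points.
    have hinj : Set.InjOn W s := by
      intro i hi j hj hij
      obtain ⟨h, hh⟩ := hpat {i} (Finset.singleton_subset_iff.2 hi)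
      have h1 := (hh i hi).2 (Finset.mem_singleton_self i)
      rw [hij] at h1
      exact (Finset.mem_singleton.1 ((hh j hj).1 h1)).symm
    rw [← Finset.card_image_of_injOn hinj]
    refine hV _ fun u hu => ?_
    obtain ⟨h, hh⟩ := hpat (s.filter fun i => W i ∈ u) (Finset.filter_subset _ _)
    refine ⟨h, fun z hz => ?_⟩
    obtain ⟨i, hi, rfl⟩ := Finset.mem_image.1 hz
    rw [hh i hi, Finset.mem_filter]
    exact ⟨fun h => h.2, fun h => ⟨hi, h⟩⟩
  have hsub : (Finset.univ.filter fun σ : ι → Bool => W ∘ ghostSwap σ ∈ B) ⊆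
      exceedSet 𝒜 ghostDiff (Fintype.card ι * ε) := by
    intro σ hσ
    obtain ⟨h, hh⟩ := (Finset.mem_filter.1 hσ).2
    refine mem_exceedSet.2 ⟨Finset.univ.filter fun i => W i ∈ E h, ?_, ?_⟩
    · exact Finset.mem_filter.2 ⟨Finset.mem_univ _, h, fun i => by simp⟩
    · refine hh.trans_le (le_of_eq ?_)
      congr 1
      rw [hitCount, hitCount, ← Finset.sum_sub_distrib]
      refine Finset.sum_congr rfl fun i _ => ?_
      simp only [ghostDiff, Finset.mem_filter, Finset.mem_univ, true_and, Set.indicator_apply]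
      -- A swap at `i` flips the sign of the `i`-th difference, which yields the Rademacher sum.
      cases hi : σ i <;> simp [ghostSwap_inl, ghostSwap_inr, hi, boolSign]
  have hcard : ((Finset.univ.filter fun σ : ι → Bool => W ∘ ghostSwap σ ∈ B).card : ℝ) ≤
      2 ^ Fintype.card ι * δ :=
    (Nat.cast_le.2 (Finset.card_le_card hsub)).trans
      (card_exists_lt_abs_sum_ghostDiff_le hVC hε hδ h)
  calc ∑ σ : ι → Bool, B.indicator (fun _ => (1 : ENNReal)) (W ∘ ghostSwap σ)
      = ((Finset.univ.filter fun σ : ι → Bool => W ∘ ghostSwap σ ∈ B).card : ENNReal) := by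
        simp [Set.indicator_apply]
    _ = ENNReal.ofReal
        ((Finset.univ.filter fun σ : ι → Bool => W ∘ ghostSwap σ ∈ B).card : ℝ) := by
        rw [ENNReal.ofReal_natCast]
    _ ≤ ENNReal.ofReal (2 ^ Fintype.card ι * δ) := ENNReal.ofReal_le_ofReal hcard
    _ = 2 ^ Fintype.card ι * ENNReal.ofReal δ := by
        rw [ENNReal.ofReal_mul (by positivity), ENNReal.ofReal_pow (by norm_num)]
        norm_num

/-- Two independent samples rarely show very different frequencies. -/
theorem measure_exists_lt_abs_hitCount_sub_hitCount_le {Z ι κ : Type*} [MeasurableSpace Z]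
    [Fintype ι] [DecidableEq ι] [Nonempty ι] (D : Measure Z) [IsProbabilityMeasure D]
    (E : κ → Set Z) {V : ℕ}
    (hpat : ∀ v : ι ⊕ ι → Bool, NullMeasurableSet {W : ι ⊕ ι → Z | ∃ h, ∀ i, W i ∈ E h ↔ v i = true}
      (Measure.pi fun _ => D))
    (hV : ∀ A : Finset Z, (∀ u ⊆ A, ∃ h, ∀ z ∈ A, z ∈ E h ↔ z ∈ u) → A.card ≤ V)
    {ε δ : ℝ} (hε : 0 < ε) (hδ : δ ≤ 1)
    (h : 8 * 16 ^ V * Real.exp (-(Fintype.card ι * ε ^ 2 / 512)) ≤ δ) :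
    (Measure.pi fun _ : ι ⊕ ι => D) {W | ∃ h, Fintype.card ι * ε <
        |hitCount (E h) (W ∘ Sum.inr) - hitCount (E h) (W ∘ Sum.inl)|} ≤ ENNReal.ofReal δ := by
  classical
  set Q := Measure.pi fun _ : ι ⊕ ι => D with hQ
  have hpt := sum_indicator_comp_ghostSwap_le (ι := ι) E hV hε hδ h
  set B := {W : ι ⊕ ι → Z | ∃ h, Fintype.card ι * ε <
        |hitCount (E h) (W ∘ Sum.inr) - hitCount (E h) (W ∘ Sum.inl)|} with hB
  have hBm : NullMeasurableSet B Q := by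
    -- Membership in `B` depends only on the pattern of hits, so `B` is a finite union of pattern
    -- events.
    have hEq : B = ⋃ v ∈ {v : ι ⊕ ι → Bool | Fintype.card ι * ε <
        |∑ i, ((if v (Sum.inr i) then 1 else 0) - (if v (Sum.inl i) then 1 else 0) : ℝ)|},
        {W : ι ⊕ ι → Z | ∃ h, ∀ i, W i ∈ E h ↔ v i = true} := by
      ext W
      simp only [hB, Set.mem_ofPred_eq, Set.mem_iUnion, exists_prop]
      constructor
      · rintro ⟨h, hh⟩
        refine ⟨fun i => decide (W i ∈ E h), ?_, h, fun i => by simp⟩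
        rw [hitCount, hitCount, ← Finset.sum_sub_distrib] at hh
        simpa [Set.indicator_apply] using hh
      · rintro ⟨v, hv, h, hh⟩
        refine ⟨h, ?_⟩
        rw [hitCount, hitCount, ← Finset.sum_sub_distrib]
        simpa [Set.indicator_apply, hh] using hv
    rw [hEq]
    exact NullMeasurableSet.biUnion (Set.to_countable _) fun v _ => hpat v
  have hswap : ∀ σ : ι → Bool,
      Q B = ∫⁻ W, B.indicator (fun _ => (1 : ENNReal)) (W ∘ ghostSwap σ) ∂Q := by
    intro σ
    have hmp := measurePreserving_comp_perm D (ghostSwap σ)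
    rw [← hmp.measure_preimage hBm, ← lintegral_indicator_one₀
      (hBm.preimage hmp.quasiMeasurePreserving)]
    rfl
  have hmeas : ∀ σ : ι → Bool,
      AEMeasurable (fun W => B.indicator (fun _ => (1 : ENNReal)) (W ∘ ghostSwap σ)) Q := by
    intro σ
    have hmp := measurePreserving_comp_perm D (ghostSwap σ)
    exact (aemeasurable_const.indicator₀ hBm).comp_quasiMeasurePreserving
      hmp.quasiMeasurePreserving
  -- Swaps preserve the law of the double sample, so `Q B` is the mean over `W` of the proportion of
  -- bad swaps, bounded pointwise by `hpt`.
  have hfin : (2 : ENNReal) ^ Fintype.card ι * Q B ≤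
      2 ^ Fintype.card ι * ENNReal.ofReal δ := by
    calc (2 : ENNReal) ^ Fintype.card ι * Q B = ∑ σ : ι → Bool, Q B := by simp
      _ = ∑ σ : ι → Bool, ∫⁻ W, B.indicator (fun _ => (1 : ENNReal)) (W ∘ ghostSwap σ) ∂Q :=
          Finset.sum_congr rfl fun σ _ => hswap σ
      _ = ∫⁻ W, ∑ σ : ι → Bool, B.indicator (fun _ => (1 : ENNReal)) (W ∘ ghostSwap σ) ∂Q :=
          (lintegral_finsetSum' _ fun σ _ => hmeas σ).symm
      _ ≤ ∫⁻ _, 2 ^ Fintype.card ι * ENNReal.ofReal δ ∂Q := lintegral_mono hpt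
      _ = _ := by simp
  exact (ENNReal.mul_le_mul_iff_right (by simp) (by simp)).1 hfin

/-- Uniform convergence of frequencies to probabilities over a class of finite VC dimension, with
the optimal rate. -/
theorem measure_exists_lt_abs_hitCount_sub_le_of_vc {Z κ : Type*} [MeasurableSpace Z]
    (D : Measure Z) [IsProbabilityMeasure D] (E : κ → Set Z)
    (hE : ∀ h, NullMeasurableSet (E h) D)
    (hpat : ∀ (m : ℕ) (v : Fin m → Bool),
      NullMeasurableSet {S : Fin m → Z | ∃ h, ∀ i, S i ∈ E h ↔ v i = true} (Measure.pi fun _ => D))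
    {V : ℕ} (hV : ∀ A : Finset Z, (∀ u ⊆ A, ∃ h, ∀ z ∈ A, z ∈ E h ↔ z ∈ u) → A.card ≤ V)
    {n : ℕ} {ε δ : ℝ} (hε : 0 < ε) (hδ : δ ≤ 1) (hn : 2 ≤ n * ε ^ 2)
    (h : 8 * 16 ^ V * Real.exp (-(n * (ε / 2) ^ 2 / 512)) ≤ δ / 2) :
    (Measure.pi fun _ : Fin n => D)
      {S | ∃ h, n * ε < |hitCount (E h) S - n * D.real (E h)|} ≤ ENNReal.ofReal δ := by
  have hn0 : n ≠ 0 := by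
    rintro rfl
    norm_num at hn
  have : Nonempty (Fin n) := Fin.pos_iff_nonempty.1 (Nat.pos_of_ne_zero hn0)
  have hsym := measure_exists_lt_abs_hitCount_sub_le (ι := Fin n) D E hE hε (by simpa using hn)
  have hpat' : ∀ v : Fin n ⊕ Fin n → Bool, NullMeasurableSet
      {W : Fin n ⊕ Fin n → Z | ∃ h, ∀ i, W i ∈ E h ↔ v i = true} (Measure.pi fun _ => D) := by
    intro v
    have hmp := measurePreserving_comp_perm D (finSumFinEquiv (m := n) (n := n)).symm
    convert (hpat (n + n) (v ∘ finSumFinEquiv.symm)).preimage hmp.quasiMeasurePreserving using 1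
    ext W
    simp only [Set.mem_ofPred_eq, Set.mem_preimage, Function.comp_apply]
    refine exists_congr fun h => ?_
    exact finSumFinEquiv.forall_congr_left (p := fun i => W i ∈ E h ↔ v i = true)
  have hQ := measure_exists_lt_abs_hitCount_sub_hitCount_le (ι := Fin n) D E hpat' hV
    (half_pos hε) (by linarith : δ / 2 ≤ 1) (by simpa using h)
  have hmp := measurePreserving_sumPiEquivProdPi (fun _ : Fin n ⊕ Fin n => D)
  have hprod := hmp.measure_preimage_equiv
    {p | ∃ h, Fintype.card (Fin n) * (ε / 2) < |hitCount (E h) p.2 - hitCount (E h) p.1|}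
  rw [← hprod] at hsym
  simp only [Fintype.card_fin] at hsym hQ
  refine hsym.trans ((mul_le_mul_right hQ 2).trans (le_of_eq ?_))
  rw [← ENNReal.ofReal_ofNat, ← ENNReal.ofReal_mul (by norm_num)]
  congr 1
  ring

/-! ### Strategic error sets and their VC dimension -/

namespace StrategicClassification

/-- The data points that `h` mislabels. -/
def errorSet {X : Type*} {R : Set ℝ} (Δ : Bool → Rule X R) (h : X → Bool) :
    Set (DataPoint X R) :=
  {p | inducedLabel Δ h p ≠ p.2.1}

theorem hitCount_errorSet {X : Type*} {R : Set ℝ} (Δ : Bool → Rule X R) (h : X → Bool) {n : ℕ}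
    (S : Fin n → DataPoint X R) : hitCount (errorSet Δ h) S = empLoss Δ h S := by
  simp [hitCount, errorSet, empLoss, Set.indicator_apply]

/-- Empirical losses are natural numbers, so the minimum is attained even over an infinite class. -/
theorem exists_isSERM {X : Type*} {R : Set ℝ} {H : Set (X → Bool)} (hH : H.Nonempty)
    (Δ : Bool → Rule X R) : ∃ A : Learner X R, IsSERM H Δ A := by
  have h : ∀ (n : ℕ) (S : Fin n → DataPoint X R),
      ∃ a, a ∈ H ∧ ∀ h ∈ H, empLoss Δ a S ≤ empLoss Δ h S := by
    intro n S
    obtain ⟨a, ha, hmin⟩ := Nat.sInf_mem (hH.image fun h => empLoss Δ h S)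
    exact ⟨a, ha, fun h hh => hmin.trans_le (Nat.sInf_le ⟨h, hh, rfl⟩)⟩
  choose A hA using h
  exact ⟨A, hA⟩

theorem measurableSet_label_eq {X : Type*} [MeasurableSpace X] {R : Set ℝ} (y : Bool) :
    MeasurableSet {p : DataPoint X R | p.2.1 = y} :=
  (measurable_fst.comp measurable_snd) (measurableSet_singleton y)

theorem IsMeasurableClass.nullMeasurableSet_errorSet {X : Type*} [MeasurableSpace X] {R : Set ℝ}
    {H : Set (X → Bool)} {Δ : Bool → Rule X R} (hM : IsMeasurableClass H Δ)
    (D : Measure (DataPoint X R)) [IsProbabilityMeasure D] {h : X → Bool} (hh : h ∈ H) :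
    NullMeasurableSet (errorSet Δ h) D := by
  have h1 := (hM D).1 h hh
  have h2 := (measurableSet_label_eq (X := X) (R := R) true).nullMeasurableSet (μ := D)
  have hEq : errorSet Δ h =
      ({p | inducedLabel Δ h p = true} \ {p | p.2.1 = true}) ∪
        ({p | p.2.1 = true} \ {p | inducedLabel Δ h p = true}) := by
    ext p
    simp only [errorSet, Set.mem_ofPred_eq, Set.mem_union, Set.mem_sdiff]
    cases inducedLabel Δ h p <;> cases p.2.1 <;> simp
  rw [hEq]
  exact (h1.diff h2).union (h2.diff h1)

/-- For fixed true labels `y`, the error pattern `v` is the induced label pattern `xor y v`; there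
are finitely many `y`. -/
theorem IsMeasurableClass.nullMeasurableSet_errorPattern {X : Type*} [MeasurableSpace X]
    {R : Set ℝ} {H : Set (X → Bool)} {Δ : Bool → Rule X R} (hM : IsMeasurableClass H Δ)
    (D : Measure (DataPoint X R)) [IsProbabilityMeasure D] (m : ℕ) (v : Fin m → Bool) :
    NullMeasurableSet
      {S : Fin m → DataPoint X R | ∃ h : H, ∀ i, S i ∈ errorSet Δ h.1 ↔ v i = true}
      (Measure.pi fun _ => D) := by
  have hEq : {S : Fin m → DataPoint X R | ∃ h : H, ∀ i, S i ∈ errorSet Δ h.1 ↔ v i = true} =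
      ⋃ y : Fin m → Bool, (⋂ i, {S : Fin m → DataPoint X R | (S i).2.1 = y i}) ∩
        {S | ∃ h ∈ H, ∀ i, inducedLabel Δ h (S i) = xor (y i) (v i)} := by
    ext S
    simp only [errorSet, Set.mem_ofPred_eq, Set.mem_iUnion, Set.mem_inter_iff, Set.mem_iInter]
    have hx : ∀ a b c : Bool, (a ≠ b ↔ c = true) ↔ a = xor b c := by decide
    constructor
    · rintro ⟨h, hh⟩
      exact ⟨fun i => (S i).2.1, fun _ => rfl, h.1, h.2, fun i => (hx _ _ _).1 (hh i)⟩
    · rintro ⟨y, hy, h, hhH, hh⟩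
      refine ⟨⟨h, hhH⟩, fun i => (hx _ _ _).2 ?_⟩
      rw [hh i, hy i]
  rw [hEq]
  refine NullMeasurableSet.iUnion fun y => NullMeasurableSet.inter ?_ ((hM D).2 m _)
  exact (MeasurableSet.iInter fun i =>
    (measurable_pi_apply i) (measurableSet_label_eq (y i))).nullMeasurableSet

/-- A shattered set of points with true label `y` has at most `SVC(Δ y)` elements. -/
theorem card_le_svc_of_shattered {X : Type*} {R : Set ℝ} {H : Set (X → Bool)}
    {Δ : Bool → Rule X R} {y : Bool} {A : Finset (DataPoint X R)} (hy : ∀ p ∈ A, p.2.1 = y)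
    (hA : ∀ u ⊆ A, ∃ h ∈ H, ∀ p ∈ A, p ∈ errorSet Δ h ↔ p ∈ u) :
    (A.card : ℕ∞) ≤ svc H R (Δ y) := by
  classical
  set e := A.equivFin.symm with he
  have hset : {v : Fin A.card → Bool | ∃ h ∈ H,
      v = fun i => h (Δ y (e i).1.1 (e i).1.2.2 h)} = Set.univ := by
    rw [Set.eq_univ_iff_forall]
    intro v
    -- To realize the labels `v`, ask for errors exactly where `v` differs from the common true
    -- label.
    obtain ⟨h, hh, hu⟩ := hA (A.filter fun p => ∃ i, (e i).1 = p ∧ v i ≠ y)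
      (Finset.filter_subset _ _)
    refine ⟨h, hh, funext fun i => ?_⟩
    have h1 := hu (e i).1 (e i).2
    have h2 : (e i).1 ∈ A.filter (fun p => ∃ i, (e i).1 = p ∧ v i ≠ y) ↔ v i ≠ y := by
      rw [Finset.mem_filter]
      constructor
      · rintro ⟨-, j, hj, hv⟩
        rwa [← e.injective (Subtype.ext hj)]
      · exact fun hv => ⟨(e i).2, i, rfl, hv⟩
    rw [h2, errorSet, Set.mem_ofPred_eq, inducedLabel, hy _ (e i).2] at h1
    have hx : ∀ a b c : Bool, (a ≠ b ↔ c ≠ b) → c = a := by decide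
    exact hx _ _ _ h1
  have hcoeff : shatterCoeff H R (Δ y) A.card = 2 ^ A.card := by
    have huniv : (Set.univ : Set (Fin A.card → Bool)).encard = 2 ^ A.card := by
      rw [Set.encard_univ, ENat.card_eq_coe_fintype_card]
      simp
    refine le_antisymm (iSup_le fun p => ?_) ?_
    · rw [← huniv]
      exact Set.encard_le_encard (Set.subset_univ _)
    · refine le_trans ?_ (le_iSup _ fun i => ((e i).1.1, (e i).1.2.2))
      rw [hset, huniv]
  exact le_iSup₂ (f := fun (n : ℕ) (_ : n ∈ {n : ℕ | shatterCoeff H R (Δ y) n = 2 ^ n}) =>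
    (n : ℕ∞)) A.card hcoeff

/-- The error sets have VC dimension at most `2 * d`. -/
theorem card_le_of_shattered {X : Type*} {R : Set ℝ} {H : Set (X → Bool)}
    {Δ : Bool → Rule X R} {d : ℕ} (hd : max (svc H R (Δ true)) (svc H R (Δ false)) ≤ d)
    {A : Finset (DataPoint X R)}
    (hA : ∀ u ⊆ A, ∃ h : H, ∀ p ∈ A, p ∈ errorSet Δ h.1 ↔ p ∈ u) : A.card ≤ 2 * d := by
  classical
  have hlabel : ∀ y, (A.filter fun p => p.2.1 = y).card ≤ d := by
    intro y
    have h1 := card_le_svc_of_shattered (H := H) (Δ := Δ) (A := A.filter fun p => p.2.1 = y)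
      (fun p hp => (Finset.mem_filter.1 hp).2) (fun u hu => by
        obtain ⟨h, hh⟩ := hA u (hu.trans (Finset.filter_subset _ _))
        exact ⟨h.1, h.2, fun p hp => hh p (Finset.mem_filter.1 hp).1⟩)
    have h2 : svc H R (Δ y) ≤ d := by
      cases y
      · exact (le_max_right _ _).trans hd
      · exact (le_max_left _ _).trans hd
    exact_mod_cast h1.trans h2
  have hsplit : (A.filter fun p => p.2.1 = true) ∪ (A.filter fun p => p.2.1 = false) = A := by
    ext p
    rw [Finset.mem_union, Finset.mem_filter, Finset.mem_filter]
    cases p.2.1 <;> simp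
  have h1 := hlabel true
  have h2 := hlabel false
  have h3 := Finset.card_union_le (A.filter fun p => p.2.1 = true)
    (A.filter fun p => p.2.1 = false)
  rw [hsplit] at h3
  omega

/-- If the strategic VC dimension vanishes then all classifiers make the same errors. -/
theorem errorSet_eq_of_svc_eq_zero {X : Type*} {R : Set ℝ} {H : Set (X → Bool)}
    {Δ : Bool → Rule X R} (hd : max (svc H R (Δ true)) (svc H R (Δ false)) ≤ (0 : ℕ))
    {g h : X → Bool} (hg : g ∈ H) (hh : h ∈ H) : errorSet Δ g = errorSet Δ h := by
  classical
  have hsub : ∀ g ∈ H, ∀ h ∈ H, errorSet Δ g ⊆ errorSet Δ h := by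
    intro g hg h hh p hpg
    by_contra hph
    -- A point that `g` gets wrong and `h` gets right is a shattered singleton.
    have := card_le_of_shattered hd (A := {p}) (fun u hu => by
      rcases Finset.subset_singleton_iff.1 hu with rfl | rfl
      · exact ⟨⟨h, hh⟩, fun q hq => by simpa [Finset.mem_singleton.1 hq] using hph⟩
      · exact ⟨⟨g, hg⟩, fun q hq => by simpa [Finset.mem_singleton.1 hq] using hpg⟩)
    simp at this
  exact (hsub g hg h hh).antisymm (hsub h hh g hg)

/-- A uniform deviation bound makes every empirical risk minimizer nearly optimal. -/
theorem stratLoss_sub_iInf_le {X : Type*} [MeasurableSpace X] {R : Set ℝ} {H : Set (X → Bool)}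
    (hH : H.Nonempty) {Δ : Bool → Rule X R} {A : Learner X R} (hA : IsSERM H Δ A)
    (D : Measure (DataPoint X R)) {n : ℕ} (hn : 0 < n) {ε : ℝ} {S : Fin n → DataPoint X R}
    (hS : ∀ h : H, |hitCount (errorSet Δ h.1) S - n * D.real (errorSet Δ h.1)| ≤ n * (ε / 2)) :
    stratLoss Δ (A n S) D - (⨅ h : H, stratLoss Δ h.1 D) ≤ ε := by
  have : Nonempty H := hH.to_subtype
  have hn' : (0 : ℝ) < n := by exact_mod_cast hn
  rw [sub_le_comm]
  refine le_ciInf fun h => ?_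
  obtain ⟨hAH, hmin⟩ := hA n S
  have h1 := (abs_le.1 (hS ⟨A n S, hAH⟩)).1
  have h2 := (abs_le.1 (hS h)).2
  have h3 : (empLoss Δ (A n S) S : ℝ) ≤ empLoss Δ h.1 S := by exact_mod_cast hmin h.1 h.2
  rw [← hitCount_errorSet, ← hitCount_errorSet] at h3
  have h4 : n * D.real (errorSet Δ (A n S)) ≤ n * (D.real (errorSet Δ h.1) + ε) := by
    dsimp only at h1
    linarith
  have h5 : D.real (errorSet Δ (A n S)) ≤ D.real (errorSet Δ h.1) + ε :=
    le_of_mul_le_mul_left h4 hn'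
  change D.real (errorSet Δ (A n S)) - ε ≤ D.real (errorSet Δ h.1)
  linarith

/-! ### Sample size and conclusion -/

/-- Here `73728 = 9 * 8192`, and the exponent is `n * ε ^ 2 / 8192`, at least `9 * (d + log (1 /
δ))`. As `log 16 ≤ 3` and `d ≥ 1`, the prefactor `16 * 16 ^ V` costs at most `3 + 6 * d ≤ 9 * d`. -/
theorem exp_sample_bound {d : ℝ} {V n : ℕ} (hd : 1 ≤ d) (hV : (V : ℝ) = 2 * d) {δ ε : ℝ}
    (hδ : 0 < δ) (hε : 0 < ε)
    (hn : 73728 * (1 / ε ^ 2) * (d + Real.log (1 / δ)) ≤ n) (hlog : 0 ≤ Real.log (1 / δ)) :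
    8 * 16 ^ V * Real.exp (-(n * (ε / 2 / 2) ^ 2 / 512)) ≤ δ / 2 := by
  have hnε : 73728 * (d + Real.log (1 / δ)) ≤ n * ε ^ 2 := by
    calc 73728 * (d + Real.log (1 / δ))
        = 73728 * (1 / ε ^ 2) * (d + Real.log (1 / δ)) * ε ^ 2 := by field_simp
      _ ≤ n * ε ^ 2 := by gcongr
  have h16 : Real.log 16 ≤ 3 := by
    rw [show (16 : ℝ) = 2 ^ 4 by norm_num, Real.log_pow]
    have := Real.log_two_lt_d9
    push_cast
    linarith
  have h1 : (16 : ℝ) * 16 ^ V * Real.exp (-(n * (ε / 2 / 2) ^ 2 / 512)) ≤ δ := by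
    rw [← Real.log_le_log_iff (by positivity) hδ, Real.log_mul (by positivity) (by positivity),
      Real.log_mul (by positivity) (by positivity), Real.log_pow, Real.log_exp, hV]
    rw [one_div, Real.log_inv] at hnε hlog
    have : 2 * d * Real.log 16 ≤ 2 * d * 3 := by gcongr
    linarith
  linarith

end StrategicClassification

open StrategicClassification in
theorem mainTheorem2 :
    ∃ C : ℝ, 0 < C ∧
      ∀ (X : Type*) [MeasurableSpace X] (H : Set (X → Bool)) (R : Set ℝ) (c : X → X → NNReal)
        (Δ : Bool → Rule X R) (d : ℕ),
        H.Nonempty →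
        (∀ y, IsBestResponseRule H R c (Δ y)) →
        IsMeasurableClass H Δ →
        max (svc H R (Δ true)) (svc H R (Δ false)) = (d : ℕ∞) →
        (∃ A : Learner X R, IsSERM H Δ A) ∧
        ∃ m : ℝ → ℝ → ℕ,
          (∀ δ ∈ Set.Ioo (0 : ℝ) 1, ∀ ε ∈ Set.Ioo (0 : ℝ) 1,
            (m δ ε : ℝ) ≤ C * (1 / ε ^ 2) * ((d : ℝ) + Real.log (1 / δ))) ∧
          ∀ A : Learner X R, IsSERM H Δ A → IsAgnosticPACLearner H Δ A m := by
  refine ⟨147456, by norm_num, ?_⟩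
  intro X _ H R c Δ d hH _ hM hd
  refine ⟨exists_isSERM hH Δ, ?_⟩
  have hlog : ∀ δ ∈ Set.Ioo (0 : ℝ) 1, 0 ≤ Real.log (1 / δ) := fun δ hδ =>
    Real.log_nonneg (by rw [le_div_iff₀ hδ.1]; linarith [hδ.2])
  -- For `d = 0` the allowed sample size tends to 0 as `δ` tends to 1, so no sample may be demanded;
  -- all classifiers then have the same loss.
  rcases Nat.eq_zero_or_pos d with rfl | hdpos
  · refine ⟨fun _ _ => 0, fun δ hδ ε hε => ?_, fun A hA δ hδ ε hε n _ D _ => ?_⟩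
    · have := hlog δ hδ
      have := hε.1
      simp only [Nat.cast_zero, zero_add]
      positivity
    · have hempty : {S | ¬ (stratLoss Δ (A n S) D - (⨅ h : H, stratLoss Δ h.1 D) ≤ ε)} = ∅ := by
        rw [Set.eq_empty_iff_forall_notMem]
        intro S hS
        refine hS ?_
        have : Nonempty H := hH.to_subtype
        rw [sub_le_comm]
        refine le_ciInf fun h => ?_
        have hEq : stratLoss Δ (A n S) D = stratLoss Δ h.1 D :=
          congrArg D.real (errorSet_eq_of_svc_eq_zero hd.le (hA n S).1 h.2)
        rw [hEq]
        linarith [hε.1]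
      rw [hempty, measure_empty]
      exact zero_le
  · have hd1 : (1 : ℝ) ≤ d := by exact_mod_cast hdpos
    have hone : ∀ ε ∈ Set.Ioo (0 : ℝ) 1, 1 ≤ 1 / ε ^ 2 := fun ε hε => by
      rw [le_div_iff₀ (pow_pos hε.1 2), one_mul]
      exact pow_le_one₀ hε.1.le hε.2.le
    refine ⟨fun δ ε => ⌈73728 * (1 / ε ^ 2) * ((d : ℝ) + Real.log (1 / δ))⌉₊,
      fun δ hδ ε hε => ?_, fun A hA δ hδ ε hε n hn D _ => ?_⟩
    -- The quantity under the ceiling is at least 1, so rounding up at most doubles it: `147456 = 2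
    -- * 73728`.
    · have h1 : 1 ≤ 73728 * (1 / ε ^ 2) * ((d : ℝ) + Real.log (1 / δ)) := by
        nlinarith [hone ε hε, hlog δ hδ]
      have h2 := Nat.ceil_lt_add_one (zero_le_one.trans h1)
      linarith
    · have hn' := Nat.ceil_le.1 hn
      have hε0 := hε.1
      have h2 : 2 ≤ n * (ε / 2) ^ 2 := by
        have : 73728 * ((d : ℝ) + Real.log (1 / δ)) ≤ n * ε ^ 2 := by
          calc 73728 * ((d : ℝ) + Real.log (1 / δ))
              = 73728 * (1 / ε ^ 2) * (d + Real.log (1 / δ)) * ε ^ 2 := by field_simp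
            _ ≤ n * ε ^ 2 := by gcongr
        nlinarith [hlog δ hδ]
      have hnpos : 0 < n := by
        rcases Nat.eq_zero_or_pos n with rfl | h
        · norm_num at h2
        · exact h
      have hunif := measure_exists_lt_abs_hitCount_sub_le_of_vc D
        (fun h : H => errorSet Δ h.1) (fun h => hM.nullMeasurableSet_errorSet D h.2)
        (hM.nullMeasurableSet_errorPattern D) (V := 2 * d)
        (fun B hB => card_le_of_shattered hd.le hB) (half_pos hε0) hδ.2.le h2
        (exp_sample_bound hd1 (by push_cast; ring) hδ.1 hε0 hn' (hlog δ hδ))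
      refine (measure_mono fun S hS => ?_).trans hunif
      by_contra hcon
      refine hS (stratLoss_sub_iInf_le hH hA D hnpos fun h => ?_)
      exact not_lt.1 fun hlt => hcon ⟨h, hlt⟩
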